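/- Let $0<\mu<\lambda$, and let $U_1,D_1,U_2,D_2,\dots$ be independent random variables, where every $U_i$ is exponentially distributed with parameter $\lambda$ and every $D_i$ is exponentially distributed with parameter $\mu$. A particle starts at the origin at time $0$ and moves on the line upward with velocity $1$ during a time $U_1$, then downward with velocity $-1$ during a time $D_1$, then upward during $U_2$, downward during $D_2$, and so on. Let $C_0$ (the renewal cycle) be the first time $t>0$ at which the particle is at the origin. Let $Y(t)=\sum_{n=1}^{N(t)}D_n$ with $N(t)=\max\{n\ge 0:\ U_1+\dots+U_n\le t\}$, and let $T_0=\inf\{t>0:\ Y(t)\ge t\}$ (infima of empty sets are $+\infty$). Then $C_0$ is equal in law to $2T_0$, $C_0<\infty$ almost surely, and $C_0$ has the probability density $$f_{C_0}(y)=\frac1y\sqrt{\frac{\lambda}{\mu}}\;e^{-\frac{(\lambda+\mu)}{2}y}\,I_1\!\left(y\sqrt{\lambda\mu}\right),\qquad y\in(0,\infty),$$ where $I_1(z)=\frac z2\sum_{k=0}^{\infty}\frac{(z^2/4)^k}{k!\,(k+1)!}$ is the modified Bessel function of the first kind of order $1$. For every integer $n\ge 0$, the $n$-th moment of $C_0$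 is finite and $$\mathbb E(C_0^n)=\frac{\lambda\,2^n\,n!}{(\lambda+\mu)^{n+1}}\;{}_2F_1\!\left(\frac{n+1}{2},\frac{n+2}{2};2;\frac{4\lambda\mu}{(\lambda+\mu)^2}\right),$$ where ${}_2F_1$ is the Gauss hypergeometric function. In particular, $$\mathbb E(C_0)=\frac{2}{\lambda-\mu},\qquad \operatorname{Var}(C_0)=\frac{4(\lambda+\mu)}{(\lambda-\mu)^3}.$$ -/

import Mathlib

open MeasureTheory ProbabilityTheory
open scoped ENNReal Nat

noncomputable section

namespace Telegraph

/-- For periods `w 0, w 1, …`, the largest `n` such that the first `n` periods are over by time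
`t`, that is `max {n | w 0 + ⋯ + w (n - 1) ≤ t}`. -/
def periodCount (w : ℕ → ℝ) (t : ℝ) : ℕ :=
  sSup {n : ℕ | ∑ i ∈ Finset.range n, w i ≤ t}

/-- Position at time `t ≥ 0` of a particle that starts at `x` and moves alternately upward with
velocity `1` during the periods `u 0, u 1, …` and downward with velocity `-1` during the periods
`d 0, d 1, …`, in the order `u 0, d 0, u 1, d 1, …`. The boundary at the origin does not influence
the motion before the first arrival there.
Here `n` is the number of complete up-down rounds by time `t`, and `r` is the time elapsed since
the end of the last of them. -/
def position (u d : ℕ → ℝ) (x t : ℝ) : ℝ :=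
  let n := periodCount (fun i => u i + d i) t
  let r := t - ∑ i ∈ Finset.range n, (u i + d i)
  x + ∑ i ∈ Finset.range n, (u i - d i) + if r ≤ u n then r else u n - (r - u n)

/-- The time `C_x` of the first arrival at the origin, after time `0`, of the motion that starts
at `x` (it is `∞` if the particle never arrives). For `x = 0` this is the renewal cycle `C_0`. -/
def arrivalTime (u d : ℕ → ℝ) (x : ℝ) : ℝ≥0∞ :=
  sInf (ENNReal.ofReal '' {t : ℝ | 0 < t ∧ position u d x t = 0})

/-- The auxiliary compound Poisson process `Y(t) = ∑_{n ≤ N(t)} D_n`, with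
`N(t) = max {n | U_1 + ⋯ + U_n ≤ t}`. -/
def compoundSum (u d : ℕ → ℝ) (t : ℝ) : ℝ :=
  ∑ i ∈ Finset.range (periodCount u t), d i

/-- The stopping time `T_x = inf {t > 0 | Y(t) ≥ x + t}` (it is `∞` if there is no such `t`). -/
def crossingTime (u d : ℕ → ℝ) (x : ℝ) : ℝ≥0∞ :=
  sInf (ENNReal.ofReal '' {t : ℝ | 0 < t ∧ x + t ≤ compoundSum u d t})

/-- The modified Bessel function of the first kind `I_n`, of integer order `n ≥ 0`. -/
def besselI (n : ℕ) (z : ℝ) : ℝ :=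
  (z / 2) ^ n * ∑' k : ℕ, (z ^ 2 / 4) ^ k / ((k ! : ℝ) * ((k + n)! : ℝ))

/-- The density of the renewal cycle `C_0` on `(0, ∞)`, extended by zero. -/
def cycleDensity (lam mu y : ℝ) : ℝ :=
  if 0 < y then
    √(lam / mu) * Real.exp (-((lam + mu) / 2 * y)) * besselI 1 (y * √(lam * mu)) / y
  else 0

end Telegraph

end

namespace Telegraph

/-! Both stopping times are decided by the first round at whose end the total downward time is at
least the total upward time (`FirstBelow`). If `S` is the upward time up to and including that
round, the auxiliary process crosses at time `S` (`crossingTime_eq`). The particle, having then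
spent equal times going up and down, is back at time `2 * S` (`arrivalTime_eq`). The strong law and
`mu < lam` make such a round exist almost surely, whence `C = 2 T < ∞`.

A product of exponential densities depends on the partial sums only through the last ones. So the
joint density of the two sums, with all earlier rounds ending above the origin, is an exponential
times the volume of interlaced partial sums, a continuous ballot number (`lintegral_staysAbove`). On
the diagonal this volume is `t ^ (2 * n) / (n! * (n + 1)!)`. Integrating out the overshoot gives
`passageDensity`; summing over `n` gives the series of `I_1`. Integrating powers of `2 * t` term by
term gives gamma integrals, whose sum is the hypergeometric series (`hasSum_cycleMoment`). -/

/-! ### Deterministic paths: both stopping times at the first round below. -/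

lemma strictMono_partialSum {w : ℕ → ℝ} (hw : ∀ i, 0 < w i) :
    StrictMono fun n => ∑ i ∈ Finset.range n, w i :=
  strictMono_nat_of_lt_succ fun n => by
    simp only [Finset.sum_range_succ]
    linarith [hw n]

lemma periodCount_eq {w : ℕ → ℝ} (hw : ∀ i, 0 < w i) {t : ℝ} {m : ℕ}
    (h₁ : ∑ i ∈ Finset.range m, w i ≤ t) (h₂ : t < ∑ i ∈ Finset.range (m + 1), w i) :
    periodCount w t = m := by
  refine IsGreatest.csSup_eq ⟨h₁, fun k hk => ?_⟩
  exact Nat.lt_succ_iff.1 ((strictMono_partialSum hw).lt_iff_lt.1 (lt_of_le_of_lt hk h₂))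

lemma exists_partialSum_le_lt {w : ℕ → ℝ} {t : ℝ} (ht : 0 ≤ t) {n : ℕ}
    (hn : t < ∑ i ∈ Finset.range (n + 1), w i) :
    ∃ m ≤ n, ∑ i ∈ Finset.range m, w i ≤ t ∧ t < ∑ i ∈ Finset.range (m + 1), w i := by
  induction n with
  | zero => exact ⟨0, le_rfl, by simpa using ht, hn⟩
  | succ k ih =>
    by_cases h : t < ∑ i ∈ Finset.range (k + 1), w i
    · obtain ⟨m, hm, h₁, h₂⟩ := ih h
      exact ⟨m, hm.trans (Nat.le_succ k), h₁, h₂⟩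
    · exact ⟨k + 1, le_rfl, not_lt.1 h, hn⟩

/-- The upward time exceeds the downward time at the end of each of the first `n` rounds. -/
def StaysAbove (u d : ℕ → ℝ) (n : ℕ) : Prop :=
  ∀ i < n, ∑ j ∈ Finset.range (i + 1), d j < ∑ j ∈ Finset.range (i + 1), u j

/-- Round `n` is the first one at whose end the downward time is at least the upward time. -/
def FirstBelow (u d : ℕ → ℝ) (n : ℕ) : Prop :=
  StaysAbove u d n ∧ ∑ j ∈ Finset.range (n + 1), u j ≤ ∑ j ∈ Finset.range (n + 1), d j

lemma StaysAbove.lt {u d : ℕ → ℝ} {n m : ℕ} (h : StaysAbove u d n) (hm : m ≠ 0) (hmn : m ≤ n) :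
    ∑ j ∈ Finset.range m, d j < ∑ j ∈ Finset.range m, u j := by
  obtain ⟨k, rfl⟩ := Nat.exists_eq_succ_of_ne_zero hm
  exact h k hmn

lemma StaysAbove.le {u d : ℕ → ℝ} {n m : ℕ} (h : StaysAbove u d n) (hmn : m ≤ n) :
    ∑ j ∈ Finset.range m, d j ≤ ∑ j ∈ Finset.range m, u j := by
  rcases eq_or_ne m 0 with rfl | hm
  · simp
  · exact (h.lt hm hmn).le

lemma FirstBelow.unique {u d : ℕ → ℝ} {m n : ℕ} (hm : FirstBelow u d m) (hn : FirstBelow u d n) :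
    m = n := by
  rcases lt_trichotomy m n with h | h | h
  · exact absurd (hn.1 m h) (not_lt.2 hm.2)
  · exact h
  · exact absurd (hm.1 n h) (not_lt.2 hn.2)

lemma exists_firstBelow {u d : ℕ → ℝ}
    (h : ∃ n, ∑ j ∈ Finset.range (n + 1), u j ≤ ∑ j ∈ Finset.range (n + 1), d j) :
    ∃ n, FirstBelow u d n := by
  classical
  exact ⟨Nat.find h, fun i hi => not_le.1 (Nat.find_min h hi), Nat.find_spec h⟩

lemma sInf_ofReal_image_eq {S : Set ℝ} {a : ℝ} (ha : a ∈ S) (h : ∀ t ∈ S, a ≤ t) :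
    sInf (ENNReal.ofReal '' S) = ENNReal.ofReal a := by
  refine IsLeast.csInf_eq ⟨⟨a, ha, rfl⟩, ?_⟩
  rintro _ ⟨t, ht, rfl⟩
  exact ENNReal.ofReal_le_ofReal (h t ht)

/-- `Y` is constant between its jumps while `t` grows, so a first crossing can only occur at a jump.
-/
lemma crossingTime_eq {u d : ℕ → ℝ} (hu : ∀ i, 0 < u i) {n : ℕ} (h : FirstBelow u d n) :
    crossingTime u d 0 = ENNReal.ofReal (∑ j ∈ Finset.range (n + 1), u j) := by
  have hmono := strictMono_partialSum hu
  refine sInf_ofReal_image_eq ⟨?_, ?_⟩ ?_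
  · simpa using hmono n.succ_pos
  · rw [compoundSum, periodCount_eq hu le_rfl (hmono (Nat.lt_succ_self _)), zero_add]
    exact h.2
  · rintro t ⟨ht, hle⟩
    by_contra! hlt
    obtain ⟨m, hm, h₁, h₂⟩ := exists_partialSum_le_lt ht.le hlt
    rw [compoundSum, periodCount_eq hu h₁ h₂] at hle
    -- Before the first jump `Y = 0`, and only the condition `0 < t` excludes a crossing.
    rcases eq_or_ne m 0 with rfl | hm0
    · simp at hle
      linarith
    · linarith [h.1.lt hm0 hm]

/-- Within a round the path is lowest at an endpoint, so the first return lies in the downward run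
of round `n`. All `n + 1` upward periods are then over, and an equal time has been spent going down.
-/
lemma arrivalTime_eq {u d : ℕ → ℝ} (hu : ∀ i, 0 < u i) (hd : ∀ i, 0 < d i) {n : ℕ}
    (h : FirstBelow u d n) :
    arrivalTime u d 0 = ENNReal.ofReal (2 * ∑ j ∈ Finset.range (n + 1), u j) := by
  have hmono := strictMono_partialSum hu
  have hw : ∀ i, 0 < u i + d i := fun i => add_pos (hu i) (hd i)
  have hpos : 0 < ∑ j ∈ Finset.range (n + 1), u j := by simpa using hmono n.succ_pos
  have hn := h.1.le (le_refl n)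
  have h2 := h.2
  have hun := hu n
  have hdn := hd n
  refine sInf_ofReal_image_eq ⟨by linarith, ?_⟩ ?_
  -- In case of equality the return falls on the end of round `n`, which `periodCount` already
  -- counts as complete.
  · rcases h2.eq_or_lt with heq | hlt
    · have hper : periodCount (fun i => u i + d i) (2 * ∑ j ∈ Finset.range (n + 1), u j) = n + 1 := by
        refine periodCount_eq hw ?_ ?_
        · rw [Finset.sum_add_distrib]
          linarith
        · rw [Finset.sum_range_succ (fun i => u i + d i), Finset.sum_add_distrib]
          linarith [hw (n + 1)]
      have hr : 2 * ∑ j ∈ Finset.range (n + 1), u j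
          - ∑ j ∈ Finset.range (n + 1), (u j + d j) = 0 := by
        rw [Finset.sum_add_distrib]
        linarith
      simp only [position, hper, hr, if_pos (hu (n + 1)).le, Finset.sum_sub_distrib]
      linarith
    · have hper : periodCount (fun i => u i + d i) (2 * ∑ j ∈ Finset.range (n + 1), u j) = n := by
        refine periodCount_eq hw ?_ ?_
        · rw [Finset.sum_add_distrib, Finset.sum_range_succ]
          linarith
        · rw [Finset.sum_add_distrib]
          linarith
      simp only [position, hper, Finset.sum_sub_distrib, Finset.sum_add_distrib]
      have hlt' : ∑ j ∈ Finset.range n, d j < u n + ∑ j ∈ Finset.range n, u j := by linarith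
      rw [Finset.sum_range_succ, if_neg (by linarith)]
      ring
  · rintro t ⟨ht, hz⟩
    by_contra! hlt
    have htn : t < ∑ j ∈ Finset.range (n + 1), (u j + d j) := by
      rw [Finset.sum_add_distrib]
      linarith
    obtain ⟨m, hm, h₁, h₂⟩ := exists_partialSum_le_lt ht.le htn
    rw [position, periodCount_eq hw h₁ h₂] at hz
    simp only [Finset.sum_sub_distrib, Finset.sum_add_distrib] at hz h₁ h₂
    have hle := h.1.le hm
    split_ifs at hz with hr
    · rcases eq_or_ne m 0 with rfl | hm0
      · simp at hz
        linarith
      · linarith [h.1.lt hm0 hm]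
    -- On a downward run of round `m`, `hz` forces `t` to be twice the upward time through round
    -- `m`. For `m = n` this contradicts `hlt`; for `m < n` it lies beyond the end of the round.
    · have hs := Finset.sum_range_succ u m
      rcases hm.eq_or_lt with rfl | hmn
      · linarith
      · linarith [h.1 m hmn]

/-! ### Continuous ballot numbers. -/

/-- Volume of the set of `0 < a₁ < ⋯ < aₙ < a`, `0 < b₁ < ⋯ < bₙ < b` with `bᵢ < aᵢ` for all `i`,
where `0 ≤ b ≤ a`. -/
noncomputable def ballotVolume (n : ℕ) (a b : ℝ) : ℝ :=
  (a * b) ^ n / ((n ! : ℝ) * n !) - n * a ^ (n - 1) * b ^ (n + 1) / ((n ! : ℝ) * (n + 1)!)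

@[fun_prop]
lemma measurable_ballotVolume (n : ℕ) : Measurable fun p : ℝ × ℝ => ballotVolume n p.1 p.2 := by
  unfold ballotVolume
  fun_prop

lemma ballotVolume_nonneg (n : ℕ) {a b : ℝ} (hb : 0 ≤ b) (hab : b ≤ a) :
    0 ≤ ballotVolume n a b := by
  have ha := hb.trans hab
  -- The factorization fails at `n = 0`, where the exponent `n - 1` is truncated.
  have h : ballotVolume n a b = a ^ (n - 1) * b ^ n * ((n + 1) * a - n * b) / (n ! * (n + 1)!)
      ∨ n = 0 := by
    rcases n with _ | n
    · exact Or.inr rfl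
    · left
      rw [ballotVolume, Nat.factorial_succ (n + 1)]
      rw [Nat.add_sub_cancel]
      push_cast
      field_simp
      ring
  rcases h with h | rfl
  · rw [h]
    have : 0 ≤ (n + 1) * a - n * b := by
      have : (n : ℝ) * b ≤ n * a := by gcongr
      linarith
    positivity
  · simp [ballotVolume]

/-- The Catalan number divided by `(2 * n)!`, times `t ^ (2 * n)`: the origin of the Bessel
coefficients. -/
lemma ballotVolume_self (n : ℕ) (t : ℝ) :
    ballotVolume n t t = t ^ (2 * n) / (n ! * (n + 1)!) := by
  rcases n with _ | n
  · simp [ballotVolume]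
  · rw [ballotVolume, Nat.factorial_succ (n + 1), Nat.add_sub_cancel]
    push_cast
    field_simp
    ring

lemma lintegral_Ioc_ofReal_deriv {f F : ℝ → ℝ} {a b : ℝ} (hab : a ≤ b) (hf : Continuous f)
    (hF : ∀ x, HasDerivAt F (f x) x) (hpos : ∀ x ∈ Set.Ioc a b, 0 ≤ f x) :
    ∫⁻ x in Set.Ioc a b, ENNReal.ofReal (f x) = ENNReal.ofReal (F b - F a) := by
  rw [← intervalIntegral.integral_eq_sub_of_hasDerivAt (fun x _ => hF x)
      (hf.intervalIntegrable a b), intervalIntegral.integral_of_le hab,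
    ofReal_integral_eq_lintegral_ofReal hf.integrableOn_Ioc]
  filter_upwards [ae_restrict_mem measurableSet_Ioc] with x hx using hpos x hx

/-- First half of the volume recursion: the last upward sum ranges above the last downward sum `b`.
The antiderivative vanishes at `x = b`. -/
lemma lintegral_ballotVolume_fst (n : ℕ) {a b : ℝ} (hb : 0 ≤ b) (hab : b ≤ a) :
    ∫⁻ x in Set.Ioc b a, ENNReal.ofReal (ballotVolume n x b) =
      ENNReal.ofReal (a ^ n * b ^ n * (a - b) / (n ! * (n + 1)!)) := by
  rw [lintegral_Ioc_ofReal_deriv (F := fun x => x ^ n * b ^ n * (x - b) / (n ! * (n + 1)!)) hab]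
  · simp
  · unfold ballotVolume
    fun_prop
  · intro x
    refine HasDerivAt.congr_deriv ((((hasDerivAt_pow n x).mul_const (b ^ n)).mul
      ((hasDerivAt_id' x).sub_const b)).div_const ((n ! : ℝ) * (n + 1)!)) ?_
    rw [ballotVolume, Nat.factorial_succ]
    rcases n with _ | n
    · simp
    · rw [Nat.add_sub_cancel]
      push_cast
      field_simp
      ring
  · exact fun x hx => ballotVolume_nonneg n hb hx.1.le

lemma lintegral_ballotVolume_snd (n : ℕ) {a m : ℝ} (hm : 0 ≤ m) (hma : m ≤ a) :
    ∫⁻ b in Set.Ioc 0 m, ENNReal.ofReal (a ^ n * b ^ n * (a - b) / (n ! * (n + 1)!)) =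
      ENNReal.ofReal (ballotVolume (n + 1) a m) := by
  rw [lintegral_Ioc_ofReal_deriv (F := fun b => ballotVolume (n + 1) a b) hm]
  · simp [ballotVolume]
  · fun_prop
  · intro x
    unfold ballotVolume
    simp only [mul_pow]
    refine HasDerivAt.congr_deriv ((((hasDerivAt_pow (n + 1) x).const_mul (a ^ (n + 1))).div_const
      (((n + 1)! : ℝ) * (n + 1)!)).sub
      (((hasDerivAt_pow (n + 1 + 1) x).const_mul (((n + 1 : ℕ) : ℝ) * a ^ (n + 1 - 1))).div_const
        (((n + 1)! : ℝ) * (n + 1 + 1)!))) ?_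
    rw [Nat.factorial_succ (n + 1), Nat.factorial_succ n]
    simp only [Nat.add_sub_cancel]
    push_cast
    field_simp
    ring
  · intro x hx
    have h1 := hx.1.le
    have h2 : 0 ≤ a - x := by linarith [hx.2]
    have h3 : 0 ≤ a := by linarith
    positivity

/-! ### Joint density after `n + 1` rounds and its recursion. -/

/-- The joint density of the upward and the downward time after `n + 1` rounds, on the event that
the former is larger after each of the first `n` rounds. -/
noncomputable def roundDensity (lam mu : ℝ) (n : ℕ) (p : ℝ × ℝ) : ℝ≥0∞ :=
  if 0 < p.1 ∧ 0 < p.2 then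
    ENNReal.ofReal ((lam * mu) ^ (n + 1) * Real.exp (-(lam * p.1 + mu * p.2))) *
      ENNReal.ofReal (ballotVolume n p.1 (min p.1 p.2))
  else 0

@[fun_prop]
lemma measurable_roundDensity (lam mu : ℝ) (n : ℕ) : Measurable (roundDensity lam mu n) := by
  unfold roundDensity
  refine Measurable.ite ?_ ?_ measurable_const
  · exact (measurableSet_lt measurable_const measurable_fst).inter
      (measurableSet_lt measurable_const measurable_snd)
  · have h : Measurable fun p : ℝ × ℝ => ballotVolume n p.1 (min p.1 p.2) :=
      (measurable_ballotVolume n).comp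
        (measurable_fst.prodMk (measurable_fst.min measurable_snd))
    fun_prop

@[fun_prop]
lemma measurable_exponentialPDF (r : ℝ) : Measurable (exponentialPDF r) :=
  (measurable_exponentialPDFReal r).ennreal_ofReal

/-- The axes are excluded because `exponentialPDF` does not vanish at zero; they form a null set. -/
lemma roundDensity_zero {lam mu : ℝ} (hlam : 0 < lam) (hmu : 0 < mu) {p : ℝ × ℝ} (h₁ : p.1 ≠ 0)
    (h₂ : p.2 ≠ 0) :
    roundDensity lam mu 0 p = exponentialPDF lam p.1 * exponentialPDF mu p.2 := by
  rw [roundDensity]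
  split_ifs with h
  · rw [exponentialPDF_of_nonneg h.1.le, exponentialPDF_of_nonneg h.2.le,
      ← ENNReal.ofReal_mul (by positivity), ← ENNReal.ofReal_mul (by positivity)]
    simp only [ballotVolume, zero_add, pow_one, pow_zero, Nat.factorial_zero, Nat.cast_one,
      CharP.cast_eq_zero, zero_mul, zero_div, sub_zero, mul_one, div_one]
    congr 1
    rw [neg_add, Real.exp_add]
    ring
  · rw [not_and_or] at h
    rcases h with h | h
    · rw [exponentialPDF_of_neg (lt_of_le_of_ne (not_lt.1 h) h₁), zero_mul]
    · rw [exponentialPDF_of_neg (lt_of_le_of_ne (not_lt.1 h) h₂), mul_zero]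

/-- The exponentials telescope to one depending on `q` alone, and the supports leave the region `0 <
p.2 < p.1 ≤ q.1`, `p.2 ≤ q.2`. Since `p.2 < q.1` there automatically, `q.2` bounds the volume only
through `min q.1 q.2`. -/
lemma roundDensity_mul_exponentialPDF {lam mu : ℝ} (hlam : 0 < lam) (hmu : 0 < mu) (n : ℕ)
    (p q : ℝ × ℝ) :
    (if p.2 < p.1 then roundDensity lam mu n p else 0) *
        (exponentialPDF lam (q.1 - p.1) * exponentialPDF mu (q.2 - p.2)) =
      ENNReal.ofReal ((lam * mu) ^ (n + 2) * Real.exp (-(lam * q.1 + mu * q.2))) *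
        (Set.Ioc 0 (min q.1 q.2)).indicator (fun b =>
          (Set.Ioc b q.1).indicator (fun a => ENNReal.ofReal (ballotVolume n a b)) p.1) p.2 := by
  by_cases h : 0 < p.2 ∧ p.2 < p.1 ∧ p.1 ≤ q.1 ∧ p.2 ≤ q.2
  · obtain ⟨h1, h2, h3, h4⟩ := h
    have hb : p.2 ∈ Set.Ioc 0 (min q.1 q.2) := ⟨h1, le_min (h2.le.trans h3) h4⟩
    have ha : p.1 ∈ Set.Ioc p.2 q.1 := ⟨h2, h3⟩
    rw [if_pos h2, Set.indicator_of_mem hb, Set.indicator_of_mem ha, roundDensity,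
      if_pos ⟨h1.trans h2, h1⟩, min_eq_right h2.le,
      exponentialPDF_of_nonneg (by linarith), exponentialPDF_of_nonneg (by linarith),
      mul_right_comm, ← ENNReal.ofReal_mul (by positivity), ← ENNReal.ofReal_mul (by positivity)]
    congr 2
    have : -(lam * q.1 + mu * q.2) = -(lam * p.1 + mu * p.2) + -(lam * (q.1 - p.1))
        + -(mu * (q.2 - p.2)) := by ring
    rw [this, Real.exp_add, Real.exp_add]
    ring
  · have hR : (Set.Ioc 0 (min q.1 q.2)).indicator (fun b =>
        (Set.Ioc b q.1).indicator (fun a => ENNReal.ofReal (ballotVolume n a b)) p.1) p.2 = 0 := by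
      by_contra hne
      have h1 := Set.mem_of_indicator_ne_zero hne
      rw [Set.indicator_of_mem h1] at hne
      have h2 := Set.mem_of_indicator_ne_zero hne
      exact h ⟨h1.1, h2.1, h2.2, h1.2.trans (min_le_right _ _)⟩
    rw [hR, mul_zero]
    by_contra hne
    obtain ⟨h1, h2⟩ := mul_ne_zero_iff.1 hne
    obtain ⟨h2, h3⟩ := mul_ne_zero_iff.1 h2
    have h4 : p.2 < p.1 := by
      by_contra h4
      simp [h4] at h1
    rw [if_pos h4, roundDensity] at h1
    have h5 : 0 < p.1 ∧ 0 < p.2 := by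
      by_contra h5
      simp [h5] at h1
    refine h ⟨h5.2, h4, ?_, ?_⟩
    · by_contra! h6
      exact h2 (exponentialPDF_of_neg (by linarith))
    · by_contra! h6
      exact h3 (exponentialPDF_of_neg (by linarith))

lemma lintegral_roundDensity_step {lam mu : ℝ} (hlam : 0 < lam) (hmu : 0 < mu) (n : ℕ)
    (q : ℝ × ℝ) :
    ∫⁻ p : ℝ × ℝ, (if p.2 < p.1 then roundDensity lam mu n p else 0) *
        (exponentialPDF lam (q.1 - p.1) * exponentialPDF mu (q.2 - p.2)) =
      roundDensity lam mu (n + 1) q := by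
  have hm : Measurable fun p : ℝ × ℝ => (if p.2 < p.1 then roundDensity lam mu n p else 0) *
        (exponentialPDF lam (q.1 - p.1) * exponentialPDF mu (q.2 - p.2)) := by
    refine Measurable.mul (Measurable.ite (measurableSet_lt measurable_snd measurable_fst)
      (by fun_prop) measurable_const) (by fun_prop)
  rw [funext fun p => roundDensity_mul_exponentialPDF hlam hmu n p q] at hm ⊢
  -- The upward coordinate is integrated first, for a fixed downward one.
  rw [Measure.volume_eq_prod, lintegral_prod_symm' _ hm]
  dsimp only
  have hin : ∀ b : ℝ, ∫⁻ a : ℝ,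
      ENNReal.ofReal ((lam * mu) ^ (n + 2) * Real.exp (-(lam * q.1 + mu * q.2))) *
        (Set.Ioc 0 (min q.1 q.2)).indicator (fun b =>
          (Set.Ioc b q.1).indicator (fun a => ENNReal.ofReal (ballotVolume n a b)) a) b =
      ENNReal.ofReal ((lam * mu) ^ (n + 2) * Real.exp (-(lam * q.1 + mu * q.2))) *
        (Set.Ioc 0 (min q.1 q.2)).indicator (fun b =>
          ENNReal.ofReal (q.1 ^ n * b ^ n * (q.1 - b) / (n ! * (n + 1)!))) b := by
    intro b
    rw [lintegral_const_mul' _ _ ENNReal.ofReal_ne_top]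
    by_cases hb : b ∈ Set.Ioc 0 (min q.1 q.2)
    · simp only [Set.indicator_of_mem hb]
      rw [lintegral_indicator measurableSet_Ioc,
        lintegral_ballotVolume_fst n hb.1.le (hb.2.trans (min_le_left _ _))]
    · simp [Set.indicator_of_notMem hb]
  simp only [hin]
  rw [lintegral_const_mul' _ _ ENNReal.ofReal_ne_top, lintegral_indicator measurableSet_Ioc,
    roundDensity]
  split_ifs with h
  · rw [lintegral_ballotVolume_snd n (le_min h.1.le h.2.le) (min_le_left _ _)]
  · rw [Set.Ioc_eq_empty (by rwa [lt_min_iff])]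
    simp

lemma expMeasure_eq_withDensity (r : ℝ) :
    expMeasure r = volume.withDensity (exponentialPDF r) := rfl

/-! ### Independence of successive rounds and the law of the state. -/

/-- The state after `n + 1` rounds. -/
noncomputable def roundState (u d : ℕ → ℝ) (n : ℕ) : ℝ × ℝ :=
  (∑ j ∈ Finset.range (n + 1), u j, ∑ j ∈ Finset.range (n + 1), d j)

lemma roundState_succ (u d : ℕ → ℝ) (n : ℕ) :
    roundState u d (n + 1) = roundState u d n + (u (n + 1), d (n + 1)) := by
  simp [roundState, Finset.sum_range_succ]

lemma staysAbove_succ {u d : ℕ → ℝ} {n : ℕ} :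
    StaysAbove u d (n + 1) ↔
      StaysAbove u d n ∧ (roundState u d n).2 < (roundState u d n).1 := by
  refine ⟨fun h => ⟨fun i hi => h i (hi.trans n.lt_succ_self), h n n.lt_succ_self⟩,
    fun h i hi => ?_⟩
  rcases Nat.lt_succ_iff_lt_or_eq.1 hi with hi | rfl
  · exact h.1 i hi
  · exact h.2

lemma roundState_congr {u d u' d' : ℕ → ℝ} {n : ℕ} (hu : ∀ i ≤ n, u i = u' i)
    (hd : ∀ i ≤ n, d i = d' i) : roundState u d n = roundState u' d' n := by
  rw [roundState, roundState]
  congr 1 <;> refine Finset.sum_congr rfl fun i hi => ?_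
  · exact hu i (Nat.lt_succ_iff.1 (Finset.mem_range.1 hi))
  · exact hd i (Nat.lt_succ_iff.1 (Finset.mem_range.1 hi))

lemma staysAbove_iff_roundState {u d : ℕ → ℝ} {n : ℕ} :
    StaysAbove u d n ↔ ∀ i < n, (roundState u d i).2 < (roundState u d i).1 := Iff.rfl

lemma staysAbove_congr {u d u' d' : ℕ → ℝ} {n : ℕ} (hu : ∀ i ≤ n, u i = u' i)
    (hd : ∀ i ≤ n, d i = d' i) : StaysAbove u d n ↔ StaysAbove u' d' n := by
  rw [staysAbove_iff_roundState, staysAbove_iff_roundState]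
  refine forall₂_congr fun i hi => ?_
  rw [roundState_congr (fun j hj => hu j (hj.trans hi.le)) fun j hj => hd j (hj.trans hi.le)]

section Measurability

variable {α : Type*} [MeasurableSpace α] {u d : ℕ → α → ℝ}

lemma measurable_roundState (hu : ∀ i, Measurable (u i)) (hd : ∀ i, Measurable (d i)) (n : ℕ) :
    Measurable fun x => roundState (fun i => u i x) (fun i => d i x) n := by
  unfold roundState
  fun_prop

lemma measurableSet_staysAbove (hu : ∀ i, Measurable (u i)) (hd : ∀ i, Measurable (d i)) (n : ℕ) :
    MeasurableSet {x | StaysAbove (fun i => u i x) (fun i => d i x) n} := by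
  simp only [staysAbove_iff_roundState, Set.ofPred_forall]
  refine MeasurableSet.iInter fun i => MeasurableSet.iInter fun _ => ?_
  exact measurableSet_lt (measurable_roundState hu hd i).snd (measurable_roundState hu hd i).fst

lemma measurableSet_firstBelow (hu : ∀ i, Measurable (u i)) (hd : ∀ i, Measurable (d i)) (n : ℕ) :
    MeasurableSet {x | FirstBelow (fun i => u i x) (fun i => d i x) n} :=
  (measurableSet_staysAbove hu hd n).inter <|
    measurableSet_le (measurable_roundState hu hd n).fst (measurable_roundState hu hd n).snd

end Measurability

/-- The finite sequence `z` extended by zero. -/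
def extendZero {S : Finset (ℕ ⊕ ℕ)} (z : S → ℝ) (i : ℕ ⊕ ℕ) : ℝ :=
  if h : i ∈ S then z ⟨i, h⟩ else 0

lemma measurable_extendZero {S : Finset (ℕ ⊕ ℕ)} (i : ℕ ⊕ ℕ) :
    Measurable fun z : S → ℝ => extendZero z i := by
  unfold extendZero
  split_ifs <;> fun_prop

section Independence

variable {Ω : Type*} [MeasurableSpace Ω] {P : Measure Ω} {U D : ℕ → Ω → ℝ}

/-- Event and state are a measurable function of the periods of index at most `n`, extended by zero;
the next round uses disjoint indices. The event enters as an indicator so that the pair is one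
random variable. -/
lemma indepFun_roundState (hU : ∀ i, Measurable (U i)) (hD : ∀ i, Measurable (D i))
    (hind : iIndepFun (Sum.elim U D) P) (n : ℕ) :
    IndepFun
      (fun ω => ({ω | StaysAbove (fun i => U i ω) (fun i => D i ω) n}.indicator 1 ω,
        roundState (fun i => U i ω) (fun i => D i ω) n) : Ω → ℝ≥0∞ × (ℝ × ℝ))
      (fun ω => (U (n + 1) ω, D (n + 1) ω)) P := by
  classical
  let S : Finset (ℕ ⊕ ℕ) := (Finset.range (n + 1)).disjSum (Finset.range (n + 1))
  let T : Finset (ℕ ⊕ ℕ) := {Sum.inl (n + 1), Sum.inr (n + 1)}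
  have hST : Disjoint S T := by
    rw [Finset.disjoint_left]
    rintro (i | i) hi <;> simp [S, T] at hi ⊢ <;> omega
  have hmeas : ∀ i, Measurable (Sum.elim U D i) := by
    rintro (i | i)
    · exact hU i
    · exact hD i
  let u' : ℕ → (S → ℝ) → ℝ := fun i z => extendZero z (Sum.inl i)
  let d' : ℕ → (S → ℝ) → ℝ := fun i z => extendZero z (Sum.inr i)
  have hu' : ∀ i, Measurable (u' i) := fun i => measurable_extendZero _
  have hd' : ∀ i, Measurable (d' i) := fun i => measurable_extendZero _
  let f : (S → ℝ) → ℝ≥0∞ × (ℝ × ℝ) := fun z =>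
    ({z | StaysAbove (fun i => u' i z) (fun i => d' i z) n}.indicator 1 z,
      roundState (fun i => u' i z) (fun i => d' i z) n)
  have hf : Measurable f := Measurable.prodMk
    (measurable_one.indicator (measurableSet_staysAbove hu' hd' n)) (measurable_roundState hu' hd' n)
  let g : (T → ℝ) → ℝ × ℝ := fun z =>
    (z ⟨Sum.inl (n + 1), by simp [T]⟩, z ⟨Sum.inr (n + 1), by simp [T]⟩)
  have hg : Measurable g := by fun_prop
  refine IndepFun.congr ((hind.indepFun_finset S T hST hmeas).comp hf hg) ?_ ?_
  · refine Filter.Eventually.of_forall fun ω => ?_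
    have hu : ∀ i ≤ n, u' i (fun j : S => Sum.elim U D j ω) = U i ω := fun i hi => by
      simp only [u', extendZero, S, Finset.inl_mem_disjSum, Finset.mem_range,
        dif_pos (Nat.lt_succ_iff.2 hi), Sum.elim_inl]
    have hd : ∀ i ≤ n, d' i (fun j : S => Sum.elim U D j ω) = D i ω := fun i hi => by
      simp only [d', extendZero, S, Finset.inr_mem_disjSum, Finset.mem_range,
        dif_pos (Nat.lt_succ_iff.2 hi), Sum.elim_inr]
    simp only [Function.comp_apply, f, Set.indicator, Set.mem_ofPred_eq, staysAbove_congr hu hd,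
      roundState_congr hu hd, Pi.one_apply]
  · exact Filter.Eventually.of_forall fun ω => rfl

variable {lam mu : ℝ}

lemma hasLaw_round [IsProbabilityMeasure P]
    (hU : ∀ i, HasLaw (U i) (expMeasure lam) P) (hD : ∀ i, HasLaw (D i) (expMeasure mu) P)
    (hind : iIndepFun (Sum.elim U D) P) (i : ℕ) :
    P.map (fun ω => (U i ω, D i ω)) =
      volume.withDensity fun p : ℝ × ℝ => exponentialPDF lam p.1 * exponentialPDF mu p.2 := by
  have h : IndepFun (U i) (D i) P := hind.indepFun (i := Sum.inl i) (j := Sum.inr i) (by simp)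
  rw [h.map_prod_eq_prod_map_map (hU i).aemeasurable (hD i).aemeasurable, (hU i).map_eq,
    (hD i).map_eq, expMeasure_eq_withDensity, expMeasure_eq_withDensity,
    prod_withDensity (by fun_prop) (by fun_prop)]
  rfl

lemma lintegral_add_round [IsProbabilityMeasure P]
    (hU : ∀ i, HasLaw (U i) (expMeasure lam) P) (hD : ∀ i, HasLaw (D i) (expMeasure mu) P)
    (hind : iIndepFun (Sum.elim U D) P) (i : ℕ) {F : ℝ × ℝ → ℝ≥0∞} (hF : Measurable F)
    (p : ℝ × ℝ) :
    ∫⁻ w, F (p + w) ∂(P.map (fun ω => (U i ω, D i ω))) =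
      ∫⁻ q : ℝ × ℝ, F q * (exponentialPDF lam (q.1 - p.1) * exponentialPDF mu (q.2 - p.2)) := by
  rw [hasLaw_round hU hD hind, lintegral_withDensity_eq_lintegral_mul _ (by fun_prop)
    (by fun_prop), ← lintegral_add_left_eq_self (fun q : ℝ × ℝ => F q *
      (exponentialPDF lam (q.1 - p.1) * exponentialPDF mu (q.2 - p.2))) p]
  simp [mul_comm]

/-- Induction on `n`: the next round is independent of the past, so the new density is the old one,
cut to `p.2 < p.1`, convolved with two exponential densities. `lintegral_roundDensity_step`
evaluates this. -/
lemma lintegral_staysAbove [IsProbabilityMeasure P] (hlam : 0 < lam) (hmu : 0 < mu)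
    (hUm : ∀ i, Measurable (U i)) (hDm : ∀ i, Measurable (D i))
    (hU : ∀ i, HasLaw (U i) (expMeasure lam) P) (hD : ∀ i, HasLaw (D i) (expMeasure mu) P)
    (hind : iIndepFun (Sum.elim U D) P) (n : ℕ) {F : ℝ × ℝ → ℝ≥0∞} (hF : Measurable F) :
    ∫⁻ ω in {ω | StaysAbove (fun i => U i ω) (fun i => D i ω) n},
        F (roundState (fun i => U i ω) (fun i => D i ω) n) ∂P =
      ∫⁻ p : ℝ × ℝ, F p * roundDensity lam mu n p := by
  induction n generalizing F with
  | zero =>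
    have h0 : {ω | StaysAbove (fun i => U i ω) (fun i => D i ω) 0} = Set.univ :=
      Set.eq_univ_of_forall fun ω i hi => absurd hi (Nat.not_lt_zero i)
    have h1 : ∀ ω, roundState (fun i => U i ω) (fun i => D i ω) 0 = (U 0 ω, D 0 ω) := fun ω => by
      simp [roundState]
    simp only [h0, Measure.restrict_univ, h1]
    rw [← lintegral_map (f := F) hF ((hUm 0).prodMk (hDm 0)),
      hasLaw_round hU hD hind, lintegral_withDensity_eq_lintegral_mul _ (by fun_prop) hF]
    refine lintegral_congr_ae ?_
    have hae : ∀ᵐ p : ℝ × ℝ, p.1 ≠ 0 ∧ p.2 ≠ 0 := by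
      have h₁ : ∀ᵐ x : ℝ, x ≠ 0 := Measure.ae_ne volume 0
      rw [Measure.volume_eq_prod]
      exact (Measure.quasiMeasurePreserving_fst.ae h₁).and
        (Measure.quasiMeasurePreserving_snd.ae h₁)
    filter_upwards [hae] with p hp
    rw [roundDensity_zero hlam hmu hp.1 hp.2, Pi.mul_apply, mul_comm]
  | succ n ih =>
    have hA := measurableSet_staysAbove hUm hDm n
    have hX := measurable_roundState hUm hDm n
    have hW : Measurable fun ω => (U (n + 1) ω, D (n + 1) ω) := (hUm _).prodMk (hDm _)
    have hI : Measurable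
        ({ω | StaysAbove (fun i => U i ω) (fun i => D i ω) n}.indicator (1 : Ω → ℝ≥0∞)) :=
      measurable_one.indicator hA
    let G : (ℝ≥0∞ × (ℝ × ℝ)) × (ℝ × ℝ) → ℝ≥0∞ := fun z =>
      z.1.1 * {p : ℝ × ℝ | p.2 < p.1}.indicator 1 z.1.2 * F (z.1.2 + z.2)
    have hlt : MeasurableSet {p : ℝ × ℝ | p.2 < p.1} :=
      measurableSet_lt measurable_snd measurable_fst
    have hi : Measurable ({p : ℝ × ℝ | p.2 < p.1}.indicator (1 : ℝ × ℝ → ℝ≥0∞)) :=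
      measurable_one.indicator hlt
    have hG : Measurable G := by fun_prop
    have hprob : IsProbabilityMeasure (P.map fun ω => (U (n + 1) ω, D (n + 1) ω)) :=
      Measure.isProbabilityMeasure_map hW.aemeasurable
    calc
      _ = ∫⁻ ω, G (({ω | StaysAbove (fun i => U i ω) (fun i => D i ω) n}.indicator 1 ω,
            roundState (fun i => U i ω) (fun i => D i ω) n), (U (n + 1) ω, D (n + 1) ω)) ∂P := by
        rw [← lintegral_indicator (measurableSet_staysAbove hUm hDm (n + 1))]
        refine lintegral_congr fun ω => ?_
        have h₃ := staysAbove_succ (u := fun i => U i ω) (d := fun i => D i ω) (n := n)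
        simp only [Set.indicator, Set.mem_ofPred_eq, roundState_succ, G, Pi.one_apply]
        by_cases h₁ : StaysAbove (fun i => U i ω) (fun i => D i ω) n <;>
        by_cases h₂ : (roundState (fun i => U i ω) (fun i => D i ω) n).2 <
          (roundState (fun i => U i ω) (fun i => D i ω) n).1 <;>
        simp only [h₁, h₂, and_true, and_false, iff_true, iff_false] at h₃ <;>
        simp [h₁, h₂, h₃]
      _ = ∫⁻ ω, ∫⁻ w, G (({ω | StaysAbove (fun i => U i ω) (fun i => D i ω) n}.indicator 1 ω,
            roundState (fun i => U i ω) (fun i => D i ω) n), w)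
              ∂(P.map fun ω => (U (n + 1) ω, D (n + 1) ω)) ∂P := by
        have h := (indepFun_roundState hUm hDm hind n).map_prod_eq_prod_map_map
          (hI.prodMk hX).aemeasurable hW.aemeasurable
        rw [← lintegral_map (f := G) hG ((hI.prodMk hX).prodMk hW), h,
          lintegral_prod _ hG.aemeasurable,
          lintegral_map hG.lintegral_prod_right' (hI.prodMk hX)]
      _ = ∫⁻ ω in {ω | StaysAbove (fun i => U i ω) (fun i => D i ω) n},
            {p : ℝ × ℝ | p.2 < p.1}.indicator (fun p => ∫⁻ q : ℝ × ℝ, F q *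
              (exponentialPDF lam (q.1 - p.1) * exponentialPDF mu (q.2 - p.2)))
              (roundState (fun i => U i ω) (fun i => D i ω) n) ∂P := by
        rw [← lintegral_indicator hA]
        refine lintegral_congr fun ω => ?_
        dsimp only [G]
        rw [lintegral_const_mul _ (by fun_prop), lintegral_add_round hU hD hind _ hF]
        simp only [Set.indicator, Pi.one_apply]
        split_ifs <;> simp
      _ = ∫⁻ p : ℝ × ℝ, {p : ℝ × ℝ | p.2 < p.1}.indicator (fun p => ∫⁻ q : ℝ × ℝ, F q *
              (exponentialPDF lam (q.1 - p.1) * exponentialPDF mu (q.2 - p.2))) p *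
            roundDensity lam mu n p := by
        refine ih (Measurable.indicator ?_ hlt)
        exact Measurable.lintegral_prod_right' (f := fun z : (ℝ × ℝ) × (ℝ × ℝ) => F z.2 *
          (exponentialPDF lam (z.2.1 - z.1.1) * exponentialPDF mu (z.2.2 - z.1.2))) (by fun_prop)
      _ = ∫⁻ p : ℝ × ℝ, ∫⁻ q : ℝ × ℝ, F q * ((if p.2 < p.1 then roundDensity lam mu n p else 0) *
              (exponentialPDF lam (q.1 - p.1) * exponentialPDF mu (q.2 - p.2))) := by
        refine lintegral_congr fun p => ?_
        by_cases hp : p.2 < p.1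
        · simp only [Set.indicator, Set.mem_ofPred_eq, if_pos hp]
          rw [← lintegral_mul_const _ (by fun_prop)]
          exact lintegral_congr fun q => by ring
        · simp [Set.indicator, hp]
      _ = ∫⁻ q : ℝ × ℝ, ∫⁻ p : ℝ × ℝ, F q * ((if p.2 < p.1 then roundDensity lam mu n p else 0) *
              (exponentialPDF lam (q.1 - p.1) * exponentialPDF mu (q.2 - p.2))) := by
        refine lintegral_lintegral_swap (Measurable.aemeasurable ?_)
        have h : Measurable fun p : ℝ × ℝ => if p.2 < p.1 then roundDensity lam mu n p else 0 :=
          Measurable.ite hlt (by fun_prop) measurable_const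
        have h' : Measurable fun z : (ℝ × ℝ) × (ℝ × ℝ) =>
            if z.1.2 < z.1.1 then roundDensity lam mu n z.1 else 0 := h.comp measurable_fst
        simp only [Function.uncurry_def]
        fun_prop
      _ = _ := by
        refine lintegral_congr fun q => ?_
        have h : Measurable fun p : ℝ × ℝ => if p.2 < p.1 then roundDensity lam mu n p else 0 :=
          Measurable.ite hlt (by fun_prop) measurable_const
        rw [lintegral_const_mul _ (by fun_prop), lintegral_roundDensity_step hlam hmu]

end Independence

/-! ### Density of the upward time at passage. -/

lemma lintegral_pow_mul_exp {r c : ℝ} (hr : 0 < r) (hc : 0 ≤ c) (N : ℕ) :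
    ∫⁻ t in Set.Ioi (0 : ℝ), ENNReal.ofReal (c * t ^ N * Real.exp (-(r * t))) =
      ENNReal.ofReal (c * N ! / r ^ (N + 1)) := by
  have h1 : ∀ t ∈ Set.Ioi (0 : ℝ), ENNReal.ofReal (c * t ^ N * Real.exp (-(r * t))) =
      ENNReal.ofReal (c * N ! / r ^ (N + 1)) * gammaPDF (N + 1) r t := fun t ht => by
    rw [gammaPDF_of_nonneg (le_of_lt ht), ← ENNReal.ofReal_mul (by positivity),
      Real.Gamma_nat_eq_factorial, add_sub_cancel_right, Real.rpow_natCast,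
      ← Nat.cast_add_one, Real.rpow_natCast]
    congr 1
    field_simp
  rw [setLIntegral_congr_fun measurableSet_Ioi h1, lintegral_const_mul' _ _ ENNReal.ofReal_ne_top]
  have h2 : ∫⁻ t in Set.Ioi (0 : ℝ), gammaPDF (N + 1) r t = 1 := by
    have h := lintegral_add_compl (μ := volume) (gammaPDF (N + 1) r) (measurableSet_Ici (a := 0))
    rwa [Set.compl_Ici, lintegral_gammaPDF_of_nonpos le_rfl, add_zero,
      lintegral_gammaPDF_eq_one (by positivity) hr, setLIntegral_congr Ioi_ae_eq_Ici.symm] at h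
  rw [h2, mul_one]

/-- The density of the upward time at the first round after which the downward time is at least
the upward time, on the event that this is round `n`. -/
noncomputable def passageDensity (lam mu : ℝ) (n : ℕ) (t : ℝ) : ℝ :=
  lam * (lam * mu) ^ n / (n ! * (n + 1)!) * t ^ (2 * n) * Real.exp (-((lam + mu) * t))

@[fun_prop]
lemma continuous_passageDensity (lam mu : ℝ) (n : ℕ) : Continuous (passageDensity lam mu n) := by
  unfold passageDensity
  fun_prop

lemma passageDensity_nonneg {lam mu : ℝ} (hlam : 0 < lam) (hmu : 0 < mu) (n : ℕ) (t : ℝ) :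
    0 ≤ passageDensity lam mu n t := by
  have : 0 ≤ t ^ (2 * n) := (even_two_mul n).pow_nonneg t
  unfold passageDensity
  positivity

lemma lintegral_Ici_exp {mu : ℝ} (hmu : 0 < mu) (a : ℝ) :
    ∫⁻ b in Set.Ici a, ENNReal.ofReal (Real.exp (-(mu * b))) =
      ENNReal.ofReal (Real.exp (-(mu * a)) / mu) := by
  have hint := integrableOn_exp_mul_Ioi (neg_neg_of_pos hmu) a
  have hval := integral_exp_mul_Ioi (neg_neg_of_pos hmu) a
  simp only [neg_mul] at hint hval
  rw [setLIntegral_congr Ioi_ae_eq_Ici.symm,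
    ← ofReal_integral_eq_lintegral_ofReal hint (Filter.Eventually.of_forall fun _ => by positivity),
    hval, neg_div_neg_eq]

/-- Beyond the diagonal the ballot volume is frozen at `(a, a)`, so only `exp (-(mu * b))` is left
to integrate. -/
lemma lintegral_roundDensity_Ici {lam mu : ℝ} (hlam : 0 < lam) (hmu : 0 < mu) (n : ℕ) (a : ℝ) :
    ∫⁻ b in Set.Ici a, roundDensity lam mu n (a, b) =
      (Set.Ioi 0).indicator (fun t => ENNReal.ofReal (passageDensity lam mu n t)) a := by
  by_cases ha : 0 < a
  · have h1 : ∀ b ∈ Set.Ici a, roundDensity lam mu n (a, b) =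
        ENNReal.ofReal ((lam * mu) ^ (n + 1) * Real.exp (-(lam * a)) * ballotVolume n a a) *
          ENNReal.ofReal (Real.exp (-(mu * b))) := fun b hb => by
      have hb' : a ≤ b := hb
      have hv := ballotVolume_nonneg n ha.le le_rfl
      rw [roundDensity, if_pos ⟨ha, ha.trans_le hb'⟩, ← ENNReal.ofReal_mul (by positivity),
        ← ENNReal.ofReal_mul (by positivity), min_eq_left hb', neg_add, Real.exp_add]
      congr 1
      ring
    rw [setLIntegral_congr_fun measurableSet_Ici h1,
      lintegral_const_mul' _ _ ENNReal.ofReal_ne_top, lintegral_Ici_exp hmu,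
      Set.indicator_of_mem (Set.mem_Ioi.2 ha)]
    have hv := ballotVolume_nonneg n ha.le le_rfl
    rw [← ENNReal.ofReal_mul (by positivity), passageDensity, ballotVolume_self, add_mul, neg_add,
      Real.exp_add, pow_succ]
    congr 1
    field_simp
  · rw [Set.indicator_of_notMem (by simpa using ha)]
    simp [roundDensity, ha]

section

variable {Ω : Type*} [MeasurableSpace Ω] {P : Measure Ω} {U D : ℕ → Ω → ℝ} {lam mu : ℝ}

lemma lintegral_firstBelow [IsProbabilityMeasure P] (hlam : 0 < lam) (hmu : 0 < mu)
    (hUm : ∀ i, Measurable (U i)) (hDm : ∀ i, Measurable (D i))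
    (hU : ∀ i, HasLaw (U i) (expMeasure lam) P) (hD : ∀ i, HasLaw (D i) (expMeasure mu) P)
    (hind : iIndepFun (Sum.elim U D) P) (n : ℕ) {G : ℝ → ℝ≥0∞} (hG : Measurable G) :
    ∫⁻ ω in {ω | FirstBelow (fun i => U i ω) (fun i => D i ω) n},
        G (∑ j ∈ Finset.range (n + 1), U j ω) ∂P =
      ∫⁻ t in Set.Ioi (0 : ℝ), G t * ENNReal.ofReal (passageDensity lam mu n t) := by
  have hle : MeasurableSet {p : ℝ × ℝ | p.1 ≤ p.2} :=
    measurableSet_le measurable_fst measurable_snd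
  have hF : Measurable ({p : ℝ × ℝ | p.1 ≤ p.2}.indicator fun p => G p.1) :=
    (hG.comp measurable_fst).indicator hle
  calc
    _ = ∫⁻ ω in {ω | StaysAbove (fun i => U i ω) (fun i => D i ω) n},
          {p : ℝ × ℝ | p.1 ≤ p.2}.indicator (fun p => G p.1)
            (roundState (fun i => U i ω) (fun i => D i ω) n) ∂P := by
      rw [← lintegral_indicator (measurableSet_staysAbove hUm hDm n),
        ← lintegral_indicator (measurableSet_firstBelow hUm hDm n)]
      refine lintegral_congr fun ω => ?_
      by_cases h₁ : StaysAbove (fun i => U i ω) (fun i => D i ω) n <;>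
      by_cases h₂ : ∑ j ∈ Finset.range (n + 1), U j ω ≤ ∑ j ∈ Finset.range (n + 1), D j ω <;>
      simp [Set.indicator, FirstBelow, roundState, h₁, h₂]
    _ = ∫⁻ p : ℝ × ℝ, {p : ℝ × ℝ | p.1 ≤ p.2}.indicator (fun p => G p.1) p *
          roundDensity lam mu n p :=
      lintegral_staysAbove hlam hmu hUm hDm hU hD hind n hF
    _ = ∫⁻ a, ∫⁻ b, {p : ℝ × ℝ | p.1 ≤ p.2}.indicator (fun p => G p.1) (a, b) *
          roundDensity lam mu n (a, b) := by
      rw [Measure.volume_eq_prod, lintegral_prod _ (by fun_prop)]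
    _ = ∫⁻ a, (Set.Ioi 0).indicator
          (fun t => G t * ENNReal.ofReal (passageDensity lam mu n t)) a := by
      refine lintegral_congr fun a => ?_
      rw [Set.indicator_mul_right, ← lintegral_roundDensity_Ici hlam hmu,
        ← lintegral_indicator measurableSet_Ici, ← lintegral_const_mul]
      · refine lintegral_congr fun b => ?_
        by_cases hab : a ≤ b <;> simp [Set.indicator, hab]
      · exact Measurable.indicator (by fun_prop) measurableSet_Ici
    _ = _ := lintegral_indicator measurableSet_Ioi _

/-! ### Almost sure existence of the passage round. -/

lemma ae_expMeasure_pos (r : ℝ) : ∀ᵐ x ∂(expMeasure r), 0 < x := by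
  rw [expMeasure_eq_withDensity, ae_withDensity_iff (by fun_prop)]
  filter_upwards [Measure.ae_ne volume (0 : ℝ)] with x hx hpdf
  by_contra! h
  exact hpdf (exponentialPDF_of_neg (lt_of_le_of_ne h hx))

lemma ae_pos {r : ℝ} {X : ℕ → Ω → ℝ} (hX : ∀ i, HasLaw (X i) (expMeasure r) P) :
    ∀ᵐ ω ∂P, ∀ i, 0 < X i ω :=
  ae_all_iff.2 fun i =>
    ((hX i).ae_iff (p := fun x => 0 < x) (measurableSet_setOfPred.1 measurableSet_Ioi)).2
      (ae_expMeasure_pos r)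

lemma lintegral_id_expMeasure {r : ℝ} (hr : 0 < r) :
    ∫⁻ x, ENNReal.ofReal x ∂(expMeasure r) = ENNReal.ofReal r⁻¹ := by
  rw [expMeasure_eq_withDensity, lintegral_withDensity_eq_lintegral_mul _ (by fun_prop)
    (by fun_prop)]
  have h : ∀ x, (exponentialPDF r * fun x => ENNReal.ofReal x) x =
      (Set.Ioi 0).indicator (fun x => ENNReal.ofReal (r * x ^ 1 * Real.exp (-(r * x)))) x := by
    intro x
    by_cases hx : 0 < x
    · rw [Set.indicator_of_mem (Set.mem_Ioi.2 hx), Pi.mul_apply, exponentialPDF_of_nonneg hx.le,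
        ← ENNReal.ofReal_mul (by positivity)]
      congr 1
      ring
    · rw [Set.indicator_of_notMem (by simpa using hx), Pi.mul_apply,
        ENNReal.ofReal_of_nonpos (not_lt.1 hx), mul_zero]
  rw [lintegral_congr h, lintegral_indicator measurableSet_Ioi, lintegral_pow_mul_exp hr hr.le]
  congr 1
  simp
  field_simp

lemma integrable_of_hasLaw_expMeasure {r : ℝ} (hr : 0 < r) {X : Ω → ℝ}
    (hX : HasLaw X (expMeasure r) P) : Integrable X P ∧ ∫ ω, X ω ∂P = r⁻¹ := by
  have hpos : 0 ≤ᵐ[P] X := by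
    have := (hX.ae_iff (p := fun x => 0 < x) (measurableSet_setOfPred.1 measurableSet_Ioi)).2
      (ae_expMeasure_pos r)
    filter_upwards [this] with ω hω using hω.le
  have hl : ∫⁻ ω, ENNReal.ofReal (X ω) ∂P = ENNReal.ofReal r⁻¹ := by
    rw [hX.lintegral_comp (f := ENNReal.ofReal) (by fun_prop), lintegral_id_expMeasure hr]
  have hint : Integrable X P := by
    refine ⟨hX.aemeasurable.aestronglyMeasurable, ?_⟩
    rw [hasFiniteIntegral_iff_ofReal hpos, hl]
    exact ENNReal.ofReal_lt_top
  refine ⟨hint, ?_⟩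
  rw [integral_eq_lintegral_of_nonneg_ae hpos hX.aemeasurable.aestronglyMeasurable, hl,
    ENNReal.toReal_ofReal (by positivity)]

lemma ae_tendsto_average {r : ℝ} (hr : 0 < r) {X : ℕ → Ω → ℝ}
    (hX : ∀ i, HasLaw (X i) (expMeasure r) P) (hind : iIndepFun X P) :
    ∀ᵐ ω ∂P, Filter.Tendsto (fun n : ℕ => (∑ i ∈ Finset.range n, X i ω) / n) Filter.atTop
      (nhds r⁻¹) := by
  have h := strong_law_ae_real X (integrable_of_hasLaw_expMeasure hr (hX 0)).1
    (fun i j hij => hind.indepFun hij) fun i => (hX i).identDistrib (hX 0)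
  rwa [(integrable_of_hasLaw_expMeasure hr (hX 0)).2] at h

/-- By the strong law the average upward period tends to `lam⁻¹`, which is below the limit `mu⁻¹`
for the downward ones. -/
lemma ae_exists_firstBelow (hmu : 0 < mu) (hlam : mu < lam)
    (hU : ∀ i, HasLaw (U i) (expMeasure lam) P) (hD : ∀ i, HasLaw (D i) (expMeasure mu) P)
    (hind : iIndepFun (Sum.elim U D) P) :
    ∀ᵐ ω ∂P, ∃ n, FirstBelow (fun i => U i ω) (fun i => D i ω) n := by
  have hindU : iIndepFun U P := hind.precomp (g := Sum.inl) Sum.inl_injective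
  have hindD : iIndepFun D P := hind.precomp (g := Sum.inr) Sum.inr_injective
  filter_upwards [ae_tendsto_average (hmu.trans hlam) hU hindU,
    ae_tendsto_average hmu hD hindD] with ω h₁ h₂
  have hlt := h₁.eventually_lt h₂ (inv_strictAnti₀ hmu hlam)
  obtain ⟨n, hn, hn1⟩ := (hlt.and (Filter.eventually_ge_atTop 1)).exists
  obtain ⟨k, rfl⟩ := Nat.exists_eq_succ_of_ne_zero (Nat.one_le_iff_ne_zero.1 hn1)
  refine exists_firstBelow ⟨k, ?_⟩
  exact ((div_lt_div_iff_of_pos_right (by positivity)).1 hn).le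

end

/-! ### Hypergeometric series and the closed forms of two moments. -/

section Series

lemma mem_eball_one {z : ℝ} (hz : |z| < 1) : z ∈ Metric.eball (0 : ℝ) 1 := by
  simpa [← ofReal_norm] using hz

lemma hasSum_ordinaryHypergeometric {a b c z : ℝ} (ha : 0 < a) (hb : 0 < b) (hc : 0 < c)
    (hz : |z| < 1) :
    HasSum (fun k : ℕ => ((k ! : ℝ)⁻¹ * (ascPochhammer ℝ k).eval a * (ascPochhammer ℝ k).eval b *
      ((ascPochhammer ℝ k).eval c)⁻¹) * z ^ k) (ordinaryHypergeometric a b c z) := by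
  have hrad : (ordinaryHypergeometricSeries ℝ a b c).radius = 1 := by
    refine ordinaryHypergeometricSeries_radius_eq_one ℝ a b c fun k => ?_
    have : (0 : ℝ) ≤ k := k.cast_nonneg
    refine ⟨?_, ?_, ?_⟩ <;> intro h <;> linarith
  have h := ((ordinaryHypergeometricSeries ℝ a b c).summable
    (by rw [hrad]; exact mem_eball_one hz)).hasSum
  rw [ordinaryHypergeometricSeries_apply_eq'] at h
  rw [ordinaryHypergeometric_eq_tsum]
  exact h

lemma hasSum_one_sub_rpow_neg (a : ℝ) {z : ℝ} (hz : |z| < 1) :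
    HasSum (fun k : ℕ => (k ! : ℝ)⁻¹ * (ascPochhammer ℝ k).eval a * z ^ k)
      ((1 - z) ^ (-a)) := by
  have h := (Real.one_add_rpow_hasFPowerSeriesOnBall_zero (a := -a)).hasSum
    (y := -z) (mem_eball_one (by rwa [abs_neg]))
  rw [zero_add, ← sub_eq_add_neg] at h
  refine h.congr_fun fun k => ?_
  have hpos : ∀ j : ℕ, (j : ℝ) ≠ -1 := fun j => by
    have : (0 : ℝ) ≤ j := j.cast_nonneg
    linarith
  -- The binomial series is the hypergeometric one with the second and third parameters equal; the
  -- value `1` is an arbitrary admissible choice.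
  rw [binomialSeries_eq_ordinaryHypergeometricSeries (b := 1) hpos]
  have hasc := (ascPochhammer_pos k (1 : ℝ) one_pos).ne'
  have := ordinaryHypergeometricSeries_apply_eq (𝔸 := ℝ) a 1 1 z k
  simp only [neg_neg]
  simp only [FormalMultilinearSeries.compContinuousLinearMap_apply, Function.comp_def]
  simp only [FunLike.coe_neg, Pi.neg_apply, ContinuousLinearMap.id_apply, neg_neg]
  rw [this, smul_eq_mul]
  field_simp

/-- Duplication formula: doubled, the factors of the two Pochhammer symbols alternate through `m +
1, m + 2, …, m + 2 * k`. -/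
lemma ascPochhammer_eval_half (m k : ℕ) :
    (ascPochhammer ℝ k).eval (((m : ℝ) + 1) / 2) * (ascPochhammer ℝ k).eval (((m : ℝ) + 2) / 2) *
      4 ^ k * m ! = (2 * k + m)! := by
  induction k with
  | zero => simp
  | succ k ih =>
    rw [ascPochhammer_succ_eval, ascPochhammer_succ_eval,
      show 2 * (k + 1) + m = (2 * k + m) + 1 + 1 by ring, Nat.factorial_succ, Nat.factorial_succ]
    push_cast
    rw [← ih]
    ring

lemma ascPochhammer_eval_two (k : ℕ) : (ascPochhammer ℝ k).eval 2 = (k + 1)! := by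
  induction k with
  | zero => simp
  | succ k ih =>
    rw [ascPochhammer_succ_eval, ih, Nat.factorial_succ (k + 1)]
    push_cast
    ring

/-- This is the series of `(1 - z) ^ (-1/2)` without its constant term, shifted by one index. -/
lemma ordinaryHypergeometric_one_three_halves {z : ℝ} (hz0 : 0 < z) (hz : z < 1) :
    ordinaryHypergeometric (1 : ℝ) (3 / 2) 2 z = 2 / z * ((1 - z) ^ (-(1 / 2) : ℝ) - 1) := by
  have habs : |z| < 1 := by rwa [abs_of_pos hz0]
  have h1 := hasSum_ordinaryHypergeometric (a := 1) (b := 3 / 2) (c := 2) one_pos (by norm_num)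
    two_pos habs
  have h2 := (hasSum_nat_add_iff' 1).2 (hasSum_one_sub_rpow_neg (1 / 2) habs)
  have hasc : ∀ k : ℕ, (ascPochhammer ℝ (k + 1)).eval (1 / 2 : ℝ) =
      1 / 2 * (ascPochhammer ℝ k).eval (3 / 2 : ℝ) := fun k => by
    rw [ascPochhammer_succ_left, Polynomial.eval_mul, Polynomial.eval_X, Polynomial.eval_comp]
    norm_num
  simp only [Finset.range_one, Finset.sum_singleton, Nat.factorial_zero, Nat.cast_one, inv_one,
    ascPochhammer_zero, Polynomial.eval_one, pow_zero, mul_one] at h2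
  refine h1.unique ?_
  refine (h2.mul_left (2 / z)).congr_fun fun k => ?_
  rw [hasc, ascPochhammer_eval_two, ascPochhammer_eval_one, Nat.factorial_succ, pow_succ]
  push_cast
  field_simp

lemma ordinaryHypergeometric_three_halves_two {z : ℝ} (hz0 : 0 < z) (hz : z < 1) :
    ordinaryHypergeometric (3 / 2 : ℝ) 2 2 z = (1 - z) ^ (-(3 / 2) : ℝ) := by
  have habs : |z| < 1 := by rwa [abs_of_pos hz0]
  refine (hasSum_ordinaryHypergeometric (by norm_num) two_pos two_pos habs).unique ?_
  refine (hasSum_one_sub_rpow_neg (3 / 2) habs).congr_fun fun k => ?_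
  rw [ascPochhammer_eval_two]
  field_simp

end Series

variable {lam mu : ℝ}

/-- A perfect square, which makes the first two moments rational. -/
lemma one_sub_four_mul_div (hmu : 0 < mu) (hlam : mu < lam) :
    1 - 4 * lam * mu / (lam + mu) ^ 2 = ((lam - mu) / (lam + mu)) ^ 2 := by
  have : lam + mu ≠ 0 := by linarith
  field_simp
  ring

lemma four_mul_div_mem (hmu : 0 < mu) (hlam : mu < lam) :
    0 < 4 * lam * mu / (lam + mu) ^ 2 ∧ 4 * lam * mu / (lam + mu) ^ 2 < 1 := by
  have hl := hmu.trans hlam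
  refine ⟨by positivity, ?_⟩
  have h := one_sub_four_mul_div hmu hlam
  have : 0 < (lam - mu) / (lam + mu) := div_pos (by linarith) (by linarith)
  have : 0 < ((lam - mu) / (lam + mu)) ^ 2 := by positivity
  linarith

lemma sq_rpow_neg_div_two {x : ℝ} (hx : 0 ≤ x) (m : ℕ) :
    (x ^ 2) ^ (-(m / 2) : ℝ) = (x ^ m)⁻¹ := by
  rw [← Real.rpow_natCast x 2, ← Real.rpow_mul hx, ← Real.rpow_natCast x m, ← Real.rpow_neg hx]
  congr 1
  push_cast
  ring

/-- The `m`-th moment of the renewal cycle in its hypergeometric form. -/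
noncomputable def cycleMoment (lam mu : ℝ) (m : ℕ) : ℝ :=
  lam * 2 ^ m * (m ! : ℝ) / (lam + mu) ^ (m + 1) *
    ordinaryHypergeometric (((m : ℝ) + 1) / 2) (((m : ℝ) + 2) / 2) (2 : ℝ)
      (4 * lam * mu / (lam + mu) ^ 2)

/-- The `k`-th term is the integral of `(2 * t) ^ m` against `passageDensity lam mu k`. -/
lemma hasSum_cycleMoment (hmu : 0 < mu) (hlam : mu < lam) (m : ℕ) :
    HasSum (fun k : ℕ => 2 ^ m * (lam * (lam * mu) ^ k / (k ! * (k + 1)!)) * (2 * k + m)! /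
      (lam + mu) ^ (2 * k + m + 1)) (cycleMoment lam mu m) := by
  have hl := hmu.trans hlam
  obtain ⟨hz0, hz1⟩ := four_mul_div_mem hmu hlam
  have h := (hasSum_ordinaryHypergeometric (a := ((m : ℝ) + 1) / 2) (b := ((m : ℝ) + 2) / 2)
    (c := 2) (by positivity) (by positivity) two_pos (by rwa [abs_of_pos hz0])).mul_left
      (lam * 2 ^ m * (m ! : ℝ) / (lam + mu) ^ (m + 1))
  refine h.congr_fun fun k => ?_
  rw [← ascPochhammer_eval_half, ascPochhammer_eval_two, div_pow, ← pow_mul, mul_pow, mul_pow, mul_pow]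
  have : lam + mu ≠ 0 := by linarith
  field_simp
  ring

lemma cycleMoment_one (hmu : 0 < mu) (hlam : mu < lam) : cycleMoment lam mu 1 = 2 / (lam - mu) := by
  obtain ⟨hz0, hz1⟩ := four_mul_div_mem hmu hlam
  have hx : 0 < (lam - mu) / (lam + mu) := div_pos (by linarith) (by linarith)
  have h := sq_rpow_neg_div_two hx.le 1
  rw [cycleMoment]
  norm_num
  rw [ordinaryHypergeometric_one_three_halves hz0 hz1, one_sub_four_mul_div hmu hlam]
  norm_num at h
  norm_num
  rw [h]
  have h1 : lam + mu ≠ 0 := by linarith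
  have h2 : lam - mu ≠ 0 := by linarith
  have h3 : lam ≠ 0 := by linarith
  have h4 := hmu.ne'
  field_simp
  ring

lemma cycleMoment_two (hmu : 0 < mu) (hlam : mu < lam) :
    cycleMoment lam mu 2 = 8 * lam / (lam - mu) ^ 3 := by
  obtain ⟨hz0, hz1⟩ := four_mul_div_mem hmu hlam
  have hx : 0 < (lam - mu) / (lam + mu) := div_pos (by linarith) (by linarith)
  have h := sq_rpow_neg_div_two hx.le 3
  rw [cycleMoment]
  norm_num
  rw [ordinaryHypergeometric_three_halves_two hz0 hz1, one_sub_four_mul_div hmu hlam]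
  norm_num at h
  rw [h]
  have h1 : lam + mu ≠ 0 := by linarith
  have h2 : lam - mu ≠ 0 := by linarith
  field_simp
  ring

/-! ### Summation to the Bessel density. -/

lemma lintegral_comp_two_mul (f : ℝ → ℝ≥0∞) (hf : Measurable f) :
    ∫⁻ t, 2 * f (2 * t) = ∫⁻ y, f y := by
  conv_rhs => rw [← Real.smul_map_volume_mul_left (two_ne_zero (α := ℝ))]
  rw [lintegral_smul_measure, lintegral_map hf (by fun_prop), lintegral_const_mul _ (by fun_prop)]
  simp

lemma hasSum_passageDensity (hmu : 0 < mu) (hlam : 0 < lam) {t : ℝ} (ht : 0 < t) :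
    HasSum (fun n => passageDensity lam mu n t) (2 * cycleDensity lam mu (2 * t)) := by
  have hsum : Summable fun k : ℕ =>
      ((2 * t * √(lam * mu)) ^ 2 / 4) ^ k / ((k ! : ℝ) * ((k + 1)! : ℝ)) := by
    refine Summable.of_nonneg_of_le (fun k => by positivity) (fun k => ?_)
      (Real.summable_pow_div_factorial ((2 * t * √(lam * mu)) ^ 2 / 4))
    gcongr
    exact le_mul_of_one_le_right (by positivity)
      (mod_cast Nat.one_le_iff_ne_zero.2 (k + 1).factorial_ne_zero)
  have h := hsum.hasSum.mul_left
    (2 * (√(lam / mu) * Real.exp (-((lam + mu) / 2 * (2 * t))) * (2 * t * √(lam * mu) / 2) ^ 1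
      / (2 * t)))
  -- The root in the density and the linear factor of `I_1` together give the constant `lam` of
  -- `passageDensity`.
  have hs : √(lam / mu) * √(lam * mu) = lam := by
    rw [← Real.sqrt_mul (by positivity), show lam / mu * (lam * mu) = lam ^ 2 by field_simp,
      Real.sqrt_sq hlam.le]
  convert! h using 1
  · funext k
    rw [passageDensity, mul_pow (2 * t), Real.sq_sqrt (by positivity), pow_one,
      show (lam + mu) / 2 * (2 * t) = (lam + mu) * t by ring,
      show (2 * t) ^ 2 * (lam * mu) / 4 = t ^ 2 * (lam * mu) by ring, mul_pow (t ^ 2), ← pow_mul]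
    have hc : 2 * (√(lam / mu) * Real.exp (-((lam + mu) * t)) * (2 * t * √(lam * mu) / 2)
        / (2 * t)) = √(lam / mu) * √(lam * mu) * Real.exp (-((lam + mu) * t)) := by
      field_simp
    rw [hc, hs]
    ring
  · rw [cycleDensity, if_pos (by linarith), besselI]
    ring

lemma cycleDensity_of_nonpos {y : ℝ} (hy : y ≤ 0) : cycleDensity lam mu y = 0 :=
  if_neg (not_lt.2 hy)

lemma tsum_ofReal_passageDensity (hmu : 0 < mu) (hlam : 0 < lam) (t : ℝ) :
    (Set.Ioi 0).indicator (fun t => ∑' n, ENNReal.ofReal (passageDensity lam mu n t)) t =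
      2 * ENNReal.ofReal (cycleDensity lam mu (2 * t)) := by
  by_cases ht : 0 < t
  · have h := hasSum_passageDensity hmu hlam ht
    rw [Set.indicator_of_mem (Set.mem_Ioi.2 ht), ← ENNReal.ofReal_tsum_of_nonneg
      (fun n => passageDensity_nonneg hlam hmu n t) h.summable, h.tsum_eq,
      ENNReal.ofReal_mul two_pos.le, ENNReal.ofReal_ofNat]
  · rw [Set.indicator_of_notMem (by simpa using ht), cycleDensity_of_nonpos (by linarith)]
    simp

lemma measurable_ofReal_cycleDensity (hmu : 0 < mu) (hlam : 0 < lam) :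
    Measurable fun y => ENNReal.ofReal (cycleDensity lam mu y) := by
  have h : (fun y => ENNReal.ofReal (cycleDensity lam mu y)) = fun y =>
      2⁻¹ * (Set.Ioi 0).indicator
        (fun t => ∑' n, ENNReal.ofReal (passageDensity lam mu n t)) (2⁻¹ * y) := by
    funext y
    rw [tsum_ofReal_passageDensity hmu hlam, ← mul_assoc,
      ENNReal.inv_mul_cancel two_ne_zero ENNReal.ofNat_ne_top, one_mul,
      mul_inv_cancel_left₀ (two_ne_zero (α := ℝ))]
  rw [h]
  have hm : Measurable ((Set.Ioi (0 : ℝ)).indicator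
      (fun t => ∑' n, ENNReal.ofReal (passageDensity lam mu n t))) :=
    Measurable.indicator (Measurable.tsum fun n => by fun_prop) measurableSet_Ioi
  fun_prop

/-! ### Law and moments of the renewal cycle. -/

section Passage

variable {Ω : Type*} [MeasurableSpace Ω] {P : Measure Ω} {U D : ℕ → Ω → ℝ}

lemma ae_firstBelow_and_eq (hmu : 0 < mu) (hlam : mu < lam)
    (hU : ∀ i, HasLaw (U i) (expMeasure lam) P) (hD : ∀ i, HasLaw (D i) (expMeasure mu) P)
    (hind : iIndepFun (Sum.elim U D) P) :
    ∀ᵐ ω ∂P, ∃ n, FirstBelow (fun i => U i ω) (fun i => D i ω) n ∧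
      0 < ∑ j ∈ Finset.range (n + 1), U j ω ∧
      arrivalTime (fun i => U i ω) (fun i => D i ω) 0 =
        ENNReal.ofReal (2 * ∑ j ∈ Finset.range (n + 1), U j ω) ∧
      crossingTime (fun i => U i ω) (fun i => D i ω) 0 =
        ENNReal.ofReal (∑ j ∈ Finset.range (n + 1), U j ω) := by
  filter_upwards [ae_exists_firstBelow hmu hlam hU hD hind, ae_pos hU, ae_pos hD] with ω h hu hd
  obtain ⟨n, hn⟩ := h
  exact ⟨n, hn, Finset.sum_pos (fun i _ => hu i) ⟨0, by simp⟩, arrivalTime_eq hu hd hn,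
    crossingTime_eq hu hn⟩

/-- The infimum runs over an uncountable set of times; almost surely it equals a countable sum over
the passage rounds, which is measurable. -/
lemma aemeasurable_arrivalTime (hmu : 0 < mu) (hlam : mu < lam)
    (hUm : ∀ i, Measurable (U i)) (hDm : ∀ i, Measurable (D i))
    (hU : ∀ i, HasLaw (U i) (expMeasure lam) P) (hD : ∀ i, HasLaw (D i) (expMeasure mu) P)
    (hind : iIndepFun (Sum.elim U D) P) :
    AEMeasurable (fun ω => arrivalTime (fun i => U i ω) (fun i => D i ω) 0) P := by
  refine ⟨fun ω => ∑' n, {ω | FirstBelow (fun i => U i ω) (fun i => D i ω) n}.indicator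
    (fun ω => ENNReal.ofReal (2 * ∑ j ∈ Finset.range (n + 1), U j ω)) ω,
    Measurable.tsum fun n =>
      Measurable.indicator (by fun_prop) (measurableSet_firstBelow hUm hDm n), ?_⟩
  filter_upwards [ae_firstBelow_and_eq hmu hlam hU hD hind] with ω h
  obtain ⟨n, hn, -, hC, -⟩ := h
  rw [hC, tsum_eq_single n fun m hm => Set.indicator_of_notMem (fun h => hm (h.unique hn)) _,
    Set.indicator_of_mem (by exact hn)]

variable [IsProbabilityMeasure P]

/-- The events `FirstBelow` for different `n` are disjoint and cover almost all of the space. -/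
lemma lintegral_arrivalTime (hmu : 0 < mu) (hlam : mu < lam)
    (hUm : ∀ i, Measurable (U i)) (hDm : ∀ i, Measurable (D i))
    (hU : ∀ i, HasLaw (U i) (expMeasure lam) P) (hD : ∀ i, HasLaw (D i) (expMeasure mu) P)
    (hind : iIndepFun (Sum.elim U D) P) {G : ℝ → ℝ≥0∞} (hG : Measurable G) :
    ∫⁻ ω, G (arrivalTime (fun i => U i ω) (fun i => D i ω) 0).toReal ∂P =
      ∑' n, ∫⁻ t in Set.Ioi (0 : ℝ), G (2 * t) * ENNReal.ofReal (passageDensity lam mu n t) := by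
  have hae := ae_firstBelow_and_eq hmu hlam hU hD hind
  let A : ℕ → Set Ω := fun n => {ω | FirstBelow (fun i => U i ω) (fun i => D i ω) n}
  have hA : ∀ n, MeasurableSet (A n) := measurableSet_firstBelow hUm hDm
  have huniv : (⋃ n, A n) =ᵐ[P] Set.univ := by
    rw [Filter.eventuallyEq_univ]
    filter_upwards [hae] with ω h
    exact Set.mem_iUnion.2 ⟨h.choose, h.choose_spec.1⟩
  rw [← setLIntegral_univ, ← setLIntegral_congr huniv, lintegral_iUnion hA
    fun m n hmn => Set.disjoint_left.2 fun ω h₁ h₂ => hmn (FirstBelow.unique h₁ h₂)]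
  refine tsum_congr fun n => ?_
  rw [← lintegral_firstBelow (hmu.trans hlam) hmu hUm hDm hU hD hind n
    (G := fun t => G (2 * t)) (by fun_prop)]
  refine setLIntegral_congr_fun_ae (hA n) ?_
  filter_upwards [hae] with ω h hn
  obtain ⟨m, hm, hpos, hC, -⟩ := h
  obtain rfl : m = n := hm.unique hn
  rw [hC, ENNReal.toReal_ofReal (by positivity)]

lemma hasLaw_arrivalTime (hmu : 0 < mu) (hlam : mu < lam)
    (hUm : ∀ i, Measurable (U i)) (hDm : ∀ i, Measurable (D i))
    (hU : ∀ i, HasLaw (U i) (expMeasure lam) P) (hD : ∀ i, HasLaw (D i) (expMeasure mu) P)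
    (hind : iIndepFun (Sum.elim U D) P) :
    HasLaw (fun ω => (arrivalTime (fun i => U i ω) (fun i => D i ω) 0).toReal)
      (volume.withDensity fun y : ℝ => ENNReal.ofReal (cycleDensity lam mu y)) P := by
  have hm := (aemeasurable_arrivalTime hmu hlam hUm hDm hU hD hind).ennreal_toReal
  have hl := hmu.trans hlam
  refine ⟨hm, Measure.ext fun s hs => ?_⟩
  have hG : Measurable (s.indicator (1 : ℝ → ℝ≥0∞)) := measurable_one.indicator hs
  have hd := measurable_ofReal_cycleDensity hmu hl
  rw [← lintegral_indicator_one hs, lintegral_map' hG.aemeasurable hm,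
    lintegral_arrivalTime hmu hlam hUm hDm hU hD hind hG,
    ← lintegral_tsum fun n => by fun_prop, withDensity_apply _ hs, ← lintegral_indicator hs,
    -- Substitution `y = 2 * t`, matching `C = 2 * S`.
    ← lintegral_comp_two_mul _ (hd.indicator hs), ← lintegral_indicator measurableSet_Ioi]
  refine lintegral_congr fun t => ?_
  simp only [ENNReal.tsum_mul_left]
  rw [Set.indicator_mul_right, tsum_ofReal_passageDensity hmu hl]
  by_cases ht : 2 * t ∈ s <;> simp [ht]

lemma lintegral_two_mul_pow_mul_passageDensity (hmu : 0 < mu) (hlam : 0 < lam) (m n : ℕ) :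
    ∫⁻ t in Set.Ioi (0 : ℝ), ENNReal.ofReal ((2 * t) ^ m) *
        ENNReal.ofReal (passageDensity lam mu n t) =
      ENNReal.ofReal (2 ^ m * (lam * (lam * mu) ^ n / (n ! * (n + 1)!)) * (2 * n + m)! /
        (lam + mu) ^ (2 * n + m + 1)) := by
  rw [← lintegral_pow_mul_exp (add_pos hlam hmu) (by positivity)]
  refine setLIntegral_congr_fun measurableSet_Ioi fun t ht => ?_
  have ht' : 0 < t := ht
  rw [← ENNReal.ofReal_mul (by positivity), passageDensity]
  congr 1
  ring

lemma moment_arrivalTime (hmu : 0 < mu) (hlam : mu < lam)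
    (hUm : ∀ i, Measurable (U i)) (hDm : ∀ i, Measurable (D i))
    (hU : ∀ i, HasLaw (U i) (expMeasure lam) P) (hD : ∀ i, HasLaw (D i) (expMeasure mu) P)
    (hind : iIndepFun (Sum.elim U D) P) (m : ℕ) :
    Integrable (fun ω => (arrivalTime (fun i => U i ω) (fun i => D i ω) 0).toReal ^ m) P ∧
      ∫ ω, (arrivalTime (fun i => U i ω) (fun i => D i ω) 0).toReal ^ m ∂P =
        cycleMoment lam mu m := by
  have hl := hmu.trans hlam
  have hm := ((aemeasurable_arrivalTime hmu hlam hUm hDm hU hD hind).ennreal_toReal.pow_const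
    m).aestronglyMeasurable
  have hpos : 0 ≤ᵐ[P] fun ω =>
      (arrivalTime (fun i => U i ω) (fun i => D i ω) 0).toReal ^ m :=
    Filter.Eventually.of_forall fun ω => by positivity
  have hs := hasSum_cycleMoment hmu hlam m
  have hnn : ∀ k : ℕ, 0 ≤ 2 ^ m * (lam * (lam * mu) ^ k / (k ! * (k + 1)!)) * (2 * k + m)! /
      (lam + mu) ^ (2 * k + m + 1) := fun k => by positivity
  have hlint : ∫⁻ ω, ENNReal.ofReal
      ((arrivalTime (fun i => U i ω) (fun i => D i ω) 0).toReal ^ m) ∂P =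
        ENNReal.ofReal (cycleMoment lam mu m) := by
    rw [lintegral_arrivalTime hmu hlam hUm hDm hU hD hind
      (G := fun y => ENNReal.ofReal (y ^ m)) (by fun_prop)]
    simp only [lintegral_two_mul_pow_mul_passageDensity hmu hl]
    rw [← ENNReal.ofReal_tsum_of_nonneg hnn hs.summable, hs.tsum_eq]
  refine ⟨⟨hm, ?_⟩, ?_⟩
  · rw [hasFiniteIntegral_iff_ofReal hpos, hlint]
    exact ENNReal.ofReal_lt_top
  · rw [integral_eq_lintegral_of_nonneg_ae hpos hm, hlint,
      ENNReal.toReal_ofReal (hs.nonneg hnn)]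

end Passage

end Telegraph

theorem mainTheorem3 {Ω : Type*} [MeasurableSpace Ω] (P : Measure Ω) [IsProbabilityMeasure P]
    (lam mu : ℝ) (hmu : 0 < mu) (hlam : mu < lam)
    (U D : ℕ → Ω → ℝ)
    (hUmeas : ∀ i, Measurable (U i)) (hDmeas : ∀ i, Measurable (D i))
    (hU : ∀ i, HasLaw (U i) (expMeasure lam) P)
    (hD : ∀ i, HasLaw (D i) (expMeasure mu) P)
    (hind : iIndepFun (Sum.elim U D) P)
    (C T : Ω → ℝ≥0∞)
    (hC : ∀ ω, C ω = Telegraph.arrivalTime (fun i => U i ω) (fun i => D i ω) 0)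
    (hT : ∀ ω, T ω = Telegraph.crossingTime (fun i => U i ω) (fun i => D i ω) 0) :
    IdentDistrib C (fun ω => 2 * T ω) P P ∧
    (∀ᵐ ω ∂P, C ω ≠ ∞) ∧
    HasLaw (fun ω => (C ω).toReal)
      (volume.withDensity fun y : ℝ => ENNReal.ofReal (Telegraph.cycleDensity lam mu y)) P ∧
    (∀ n : ℕ, Integrable (fun ω => (C ω).toReal ^ n) P ∧
      ∫ ω, (C ω).toReal ^ n ∂P =
        lam * 2 ^ n * (n ! : ℝ) / (lam + mu) ^ (n + 1) *
          ordinaryHypergeometric (((n : ℝ) + 1) / 2) (((n : ℝ) + 2) / 2) (2 : ℝ)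
            (4 * lam * mu / (lam + mu) ^ 2)) ∧
    ∫ ω, (C ω).toReal ∂P = 2 / (lam - mu) ∧
    variance (fun ω => (C ω).toReal) P = 4 * (lam + mu) / (lam - mu) ^ 3 := by
  have hl := hmu.trans hlam
  obtain rfl : C = fun ω => Telegraph.arrivalTime (fun i => U i ω) (fun i => D i ω) 0 := funext hC
  obtain rfl : T = fun ω => Telegraph.crossingTime (fun i => U i ω) (fun i => D i ω) 0 := funext hT
  have hae := Telegraph.ae_firstBelow_and_eq hmu hlam hU hD hind
  have hmom := Telegraph.moment_arrivalTime hmu hlam hUmeas hDmeas hU hD hind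
  have hm := Telegraph.aemeasurable_arrivalTime hmu hlam hUmeas hDmeas hU hD hind
  have h1 := (hmom 1).2
  simp only [pow_one, Telegraph.cycleMoment_one hmu hlam] at h1
  refine ⟨IdentDistrib.of_ae_eq hm ?_, ?_,
    Telegraph.hasLaw_arrivalTime hmu hlam hUmeas hDmeas hU hD hind, hmom, h1, ?_⟩
  · filter_upwards [hae] with ω h
    obtain ⟨n, -, -, hCn, hTn⟩ := h
    rw [hCn, hTn, ENNReal.ofReal_mul two_pos.le, ENNReal.ofReal_ofNat]
  · filter_upwards [hae] with ω h
    obtain ⟨n, -, -, hCn, -⟩ := h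
    rw [hCn]
    exact ENNReal.ofReal_ne_top
  · rw [variance_eq_sub ((memLp_two_iff_integrable_sq hm.ennreal_toReal.aestronglyMeasurable).2
      (hmom 2).1), h1]
    simp only [Pi.pow_apply, (hmom 2).2, Telegraph.cycleMoment_two hmu hlam]
    have : lam - mu ≠ 0 := by linarith
    field_simp
    ring
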